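/- **Theorem.** Let $K$ be a knot in the 3-sphere, that is, a class of oriented knot diagrams on the 2-sphere up to Reidemeister moves. For a diagram $D$ of $K$ let $\pi(K)=\langle X\mid R\rangle$ be the Wirtinger presentation of the knot group read off from $D$: $X$ has one generator for each unbroken strand of $D$ and $R$ has one relator for each crossing, saying that the generators of the two under-strands are conjugate by the generator of the over-strand, in the direction given by the sign of the crossing. A *meridian* is an element of $\pi(K)$ that is conjugate to $x$ or $x^{-1}$ for some $x\in X$. Let $$\mathcal R_4(K)=\big\langle X \;\big|\; R\cup\{(cd)^2(dc)^{-2} : c,d\in\mathcal C\}\big\rangle,\qquad \mathcal C=\{g x^{\pm1} g^{-1} : g \text{ a word in } X\cup X^{-1},\ x\in X\},$$ and let $\mathcal S_4(K)=\mathcal R_4(K)/H$, where $H$ is the normal subgroup of $\mathcal R_4(K)$ generated by $\{x^2 : x\in X\}$. 1. If $K$ has bridge number $3$ (the least number of overbridges, i.e. of maximal strands passing over at least one crossing and under none, in a diagram of $K$, is $3$), then $\mathcal S_4(K)\cong\mathbb Z_2$ and $\mathcal R_4(K)\cong\mathbb Z$. 2. More generally, if $\pi(K)$ is generated by $3$ (not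 necessarily distinct) meridians, then $\mathcal S_4(K)\cong\mathbb Z_2$ and $\mathcal R_4(K)\cong\mathbb Z$. Both conclusions hold whichever diagram of $K$ is used to define $\mathcal R_4(K)$ and $\mathcal S_4(K)$. -/

import Mathlib

namespace FourMove

/-! ### Oriented knot diagrams as signed Gauss codes -/

/-- One passage of an oriented knot through a crossing of its diagram: the name of the crossing,
whether the knot passes along the over-strand, and whether the crossing is positive,
i.e. whether the directions of the over-strand and the under-strand, in this order, form a
positive basis of the plane. -/
structure Passage where
  label : ℕ
  isOver : Bool
  isPos : Bool
  deriving DecidableEq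

/-- The other passage through the same crossing. -/
def Passage.partner (p : Passage) : Passage := ⟨p.label, !p.isOver, p.isPos⟩

/-- The cyclic word of passages met when the knot is traversed once from a base point. -/
abbrev GaussWord := List Passage

namespace GaussWord

/-- Every crossing that occurs is passed exactly twice, once over and once under,
with one and the same sign. -/
def IsCode (w : GaussWord) : Prop :=
  w.Nodup ∧ (∀ p ∈ w, p.partner ∈ w) ∧ ∀ p ∈ w, ∀ q ∈ w, p.label = q.label → p.isPos = q.isPos

/-- The cyclically next position. -/
def next (w : GaussWord) (i : Fin w.length) : Fin w.length := finRotate w.length i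

/-- The cyclically previous position. -/
def prev (w : GaussWord) (i : Fin w.length) : Fin w.length := (finRotate w.length).symm i

/-- The position of the other passage through the crossing at position `i`. -/
def mate (w : GaussWord) (i : Fin w.length) : Fin w.length :=
  ((List.finRange w.length).find? fun j => decide (w.get j = (w.get i).partner)).getD i

/-- A directed edge of the underlying 4-valent graph of a (nonempty) code: `(i, true)` is the edge
from passage `i` to the next passage, traversed forwards; `(i, false)` is the same edge traversed
backwards. -/
abbrev Dart (w : GaussWord) := Fin w.length × Bool

/-- Walk along a directed edge to the crossing at its end and turn left there. Seen from the
strand passing at position `p`, the other strand of the crossing runs from right to left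
iff (`p` passes over and the sign is positive) or (`p` passes under and the sign is negative). -/
def turnLeft (w : GaussWord) (d : Dart w) : Dart w :=
  let p := if d.2 then w.next d.1 else d.1
  let crossesToLeft : Bool := (w.get p).isOver == (w.get p).isPos
  if crossesToLeft = d.2 then (w.mate p, true) else (w.prev (w.mate p), false)

/-- The faces of the cellular surface of the code: the orbits of `turnLeft`. -/
def faces (w : GaussWord) : Finset (Finset (Dart w)) :=
  Finset.univ.image fun d =>
    (Finset.range (2 * w.length)).image fun k => (turnLeft w)^[k] d

/-- The code is that of a diagram on the 2-sphere. A code with `n ≥ 1` crossings has length `2n`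
and `n` vertices, `2n` edges, so Euler's formula says that there are `n + 2` faces.
The empty code is the crossingless circle. -/
def IsPlanar (w : GaussWord) : Prop := w = [] ∨ 2 * w.faces.card = w.length + 4

end GaussWord

/-- An oriented knot diagram on the 2-sphere. -/
structure KnotDiagram where
  word : GaussWord
  isCode : word.IsCode
  isPlanar : word.IsPlanar

/-! ### Reidemeister moves -/

/-- The two-letter word `x y`, or `y x`, according to the direction of travel. -/
def strand (d : Bool) (x y : Passage) : GaussWord := if d then [x, y] else [y, x]

/-- Elementary changes of Gauss codes: change of base point, renaming of crossings, and the
Reidemeister moves for all orientations. In the third move the top strand crosses the other two at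
`a`, `b`, and the middle strand crosses the bottom strand at `c`; `dt`, `dm`, `db` are the
directions of the three strands along the sides of the triangle. The two conditions on the signs
hold precisely if these three sides bound a triangle. -/
inductive Move : GaussWord → GaussWord → Prop
  | rotate (A B : GaussWord) : Move (A ++ B) (B ++ A)
  | relabel (σ : Equiv.Perm ℕ) (A : GaussWord) :
      Move A (A.map fun p => ⟨σ p.label, p.isOver, p.isPos⟩)
  | first (k : ℕ) (o s : Bool) (A : GaussWord) :
      Move A ([⟨k, o, s⟩, ⟨k, !o, s⟩] ++ A)
  | second (k l : ℕ) (o s d : Bool) (A B : GaussWord) :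
      Move (A ++ B)
        ([⟨k, o, s⟩, ⟨l, o, !s⟩] ++ A ++ strand d ⟨k, !o, s⟩ ⟨l, !o, !s⟩ ++ B)
  | third (a b c : ℕ) (sa sb sc dt dm db : Bool) (A B C : GaussWord)
      (hab : (sa ^^ sb) = (dm ^^ db)) (hac : (sa ^^ sc) = (dt ^^ db)) :
      Move
        (strand dt ⟨a, true, sa⟩ ⟨b, true, sb⟩ ++ A ++
          strand dm ⟨a, false, sa⟩ ⟨c, true, sc⟩ ++ B ++
          strand db ⟨b, false, sb⟩ ⟨c, false, sc⟩ ++ C)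
        (strand (!dt) ⟨a, true, sa⟩ ⟨b, true, sb⟩ ++ A ++
          strand (!dm) ⟨a, false, sa⟩ ⟨c, true, sc⟩ ++ B ++
          strand (!db) ⟨b, false, sb⟩ ⟨c, false, sc⟩ ++ C)
  | third' (a b c : ℕ) (sa sb sc dt dm db : Bool) (A B C : GaussWord)
      (hab : (sa ^^ sb) = (dm ^^ db)) (hac : (sa ^^ sc) = (dt ^^ db)) :
      Move
        (strand dt ⟨a, true, sa⟩ ⟨b, true, sb⟩ ++ A ++
          strand db ⟨b, false, sb⟩ ⟨c, false, sc⟩ ++ B ++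
          strand dm ⟨a, false, sa⟩ ⟨c, true, sc⟩ ++ C)
        (strand (!dt) ⟨a, true, sa⟩ ⟨b, true, sb⟩ ++ A ++
          strand (!db) ⟨b, false, sb⟩ ⟨c, false, sc⟩ ++ B ++
          strand (!dm) ⟨a, false, sa⟩ ⟨c, true, sc⟩ ++ C)

/-- Knot diagrams up to Reidemeister moves, all intermediate diagrams lying on the sphere. -/
def KnotDiagram.setoid : Setoid KnotDiagram :=
  Relation.EqvGen.setoid fun D E => Move D.word E.word

/-- An (oriented) classical knot: a Reidemeister equivalence class of diagrams. -/
def Knot := Quotient KnotDiagram.setoid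

/-- `D` is a diagram of the knot `K`. -/
def KnotDiagram.Represents (D : KnotDiagram) (K : Knot) : Prop :=
  Quotient.mk KnotDiagram.setoid D = K

/-! ### Bridge number -/

/-- The number of overbridges of a diagram, i.e. of maximal strands that pass over at least one
crossing and under none (counted at their starting points); the crossingless circle counts as
one bridge. -/
def KnotDiagram.bridgeCount (D : KnotDiagram) : ℕ :=
  if D.word = [] then 1 else
    (Finset.univ.filter fun i : Fin D.word.length =>
      (D.word.get i).isOver = false ∧ (D.word.get (D.word.next i)).isOver = true).card

/-- The bridge number of a knot: the least number of overbridges in a diagram of it. -/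
noncomputable def Knot.bridgeNumber (K : Knot) : ℕ :=
  sInf {n | ∃ D : KnotDiagram, D.Represents K ∧ D.bridgeCount = n}

/-! ### The Wirtinger presentation -/

/-- The base point cuts the knot into edges `0, …, length`, where passage `i` leads from edge `i`
to edge `i + 1`. The last edge continues the edge `0` through the base point, and an over-passage
does not interrupt the strand. -/
inductive KnotDiagram.Joined (D : KnotDiagram) :
    Fin (D.word.length + 1) → Fin (D.word.length + 1) → Prop
  | basePoint : Joined D (Fin.last _) 0
  | overpass (i : Fin D.word.length) (h : (D.word.get i).isOver = true) :
      Joined D i.castSucc i.succ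

/-- The unbroken strands of the diagram. -/
def KnotDiagram.Arc (D : KnotDiagram) := Quot D.Joined

/-- The Wirtinger generator of the strand that contains a given edge. -/
def KnotDiagram.gen (D : KnotDiagram) (e : Fin (D.word.length + 1)) : FreeGroup D.Arc :=
  FreeGroup.of (Quot.mk D.Joined e)

/-- The Wirtinger relators: if passage `i` goes under the crossing whose over-passage is `j`, then
the generator behind the crossing is the conjugate of the generator in front of it by the
generator of the over-strand, or by its inverse, according to the sign. -/
def KnotDiagram.wirtingerRels (D : KnotDiagram) : Set (FreeGroup D.Arc) :=
  {r | ∃ i j : Fin D.word.length,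
    (D.word.get i).isOver = false ∧ D.word.get j = (D.word.get i).partner ∧
      r = if (D.word.get i).isPos
        then D.gen j.castSucc * D.gen i.succ * (D.gen i.castSucc * D.gen j.castSucc)⁻¹
        else D.gen i.succ * D.gen j.castSucc * (D.gen j.castSucc * D.gen i.castSucc)⁻¹}

/-- The knot group `π(K)`, by its Wirtinger presentation. -/
abbrev KnotDiagram.WirtingerGroup (D : KnotDiagram) := PresentedGroup D.wirtingerRels

/-- Meridians: the conjugates of the Wirtinger generators and of their inverses. -/
def KnotDiagram.IsMeridian (D : KnotDiagram) (g : D.WirtingerGroup) : Prop :=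
  ∃ x : D.Arc, IsConj (PresentedGroup.of x) g ∨ IsConj (PresentedGroup.of x)⁻¹ g

/-- The group of `K` is generated by `n` (not necessarily distinct) meridians. -/
def Knot.GroupGeneratedByMeridians (K : Knot) (n : ℕ) : Prop :=
  ∃ D : KnotDiagram, D.Represents K ∧ ∃ m : Fin n → D.WirtingerGroup,
    (∀ i, D.IsMeridian (m i)) ∧ Subgroup.closure (Set.range m) = ⊤

/-! ### The groups `R₄` and `S₄` -/

/-- The words `g x^{±1} g⁻¹` with `x` a Wirtinger generator. -/
def KnotDiagram.conjugates (D : KnotDiagram) : Set (FreeGroup D.Arc) :=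
  {c | ∃ (g : FreeGroup D.Arc) (x : D.Arc),
    c = g * FreeGroup.of x * g⁻¹ ∨ c = g * (FreeGroup.of x)⁻¹ * g⁻¹}

/-- The relators `(c d)² (d c)⁻²`, with `c` and `d` conjugates of generators or their inverses. -/
def KnotDiagram.fourMoveRels (D : KnotDiagram) : Set (FreeGroup D.Arc) :=
  {r | ∃ c ∈ D.conjugates, ∃ d ∈ D.conjugates, r = (c * d) ^ 2 * ((d * c) ^ 2)⁻¹}

/-- The Dabkowski–Sahi group of the diagram. -/
abbrev KnotDiagram.R₄ (D : KnotDiagram) := PresentedGroup (D.wirtingerRels ∪ D.fourMoveRels)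

/-- The normal subgroup of `R₄` generated by the squares of the Wirtinger generators. -/
def KnotDiagram.squares (D : KnotDiagram) : Subgroup D.R₄ :=
  Subgroup.normalClosure (Set.range fun x : D.Arc => (PresentedGroup.of x : D.R₄) ^ 2)

instance (D : KnotDiagram) : D.squares.Normal := Subgroup.normalClosure_normal

/-- The quotient of `R₄` by the squares of the Wirtinger generators. -/
abbrev KnotDiagram.S₄ (D : KnotDiagram) := D.R₄ ⧸ D.squares

end FourMove

/-!
Let `G` be a group in which `(yz)² = (zy)²` for all conjugates `y`, `z` of `x` and `x⁻¹`, and which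
is generated by three such elements `a`, `b`, `c`. Then `G` is cyclic. If `x² = 1`, the relation
says that `y` commutes with `zyz⁻¹`. The elements `(bc)ⁱb` are conjugates of `b` or `c`, so the
subgroup `E` generated by the conjugates of `a` by powers of `bc` commutes elementwise with
`bEb⁻¹`. Both `b` and `c` interchange `E` and `bEb⁻¹`, which therefore generate a normal subgroup
containing `a`, that is, all of `G`. Hence `E` is normal, so `E = G`, and `G` commutes with
`bGb⁻¹ = G`. In general, the quotient by the normal closure of `x²` is thus generated by the image
of `x`. Both `x` and the squares of the conjugates of `x` commute with `x²`, so `x²` is central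
and `G` is abelian, hence generated by `x`.

Homomorphisms from the knot group to `G` are colorings of the diagram by `G`. A Reidemeister move
carries each coloring to one that has a conjugate color at the base point and whose colors
generate no smaller subgroup. For the tautological coloring by the knot group this yields a
surjection between Wirtinger groups that maps meridians to meridians, so generation by `n`
meridians does not depend on the diagram. The meridians of the overbridges generate the knot
group, since the colors of the over-strands and of one further strand determine all others.
-/

namespace FourMove

/-! ### Groups generated by three conjugates -/

section SignedConjugates

variable {G H : Type*} [Group G] [Group H]

/-- The conjugates of `a` and of `a⁻¹`: if `a` is a Wirtinger generator, these are the
meridians. -/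
def signedConjugates (a : G) : Set G :=
  {g | IsConj a g ∨ IsConj a⁻¹ g}

theorem isConj_inv {a b : G} (h : IsConj a b) : IsConj a⁻¹ b⁻¹ := by
  obtain ⟨u, rfl⟩ := isConj_iff.1 h
  exact isConj_iff.2 ⟨u, conj_inv.symm⟩

theorem mem_signedConjugates_self (a : G) : a ∈ signedConjugates a :=
  .inl (IsConj.refl a)

theorem inv_mem_signedConjugates {a g : G} (hg : g ∈ signedConjugates a) :
    g⁻¹ ∈ signedConjugates a :=
  hg.symm.imp (fun h => by simpa using isConj_inv h) isConj_inv

theorem signedConjugates_eq_of_isConj {a b : G} (h : IsConj a b) :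
    signedConjugates a = signedConjugates b :=
  Set.ext fun _ => or_congr ⟨h.symm.trans, h.trans⟩
    ⟨(isConj_inv h).symm.trans, (isConj_inv h).trans⟩

theorem map_mem_signedConjugates (f : G →* H) {a g : G} (hg : g ∈ signedConjugates a) :
    f g ∈ signedConjugates (f a) :=
  hg.imp f.map_isConj fun h => by simpa only [map_inv] using f.map_isConj h

theorem exists_signedConjugates_map_eq {f : G →* H} (hf : Function.Surjective f) {a : G} {y : H}
    (hy : y ∈ signedConjugates (f a)) : ∃ x ∈ signedConjugates a, f x = y := by
  rcases hy with hy | hy <;> obtain ⟨v, rfl⟩ := isConj_iff.1 hy <;> obtain ⟨u, rfl⟩ := hf v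
  · exact ⟨u * a * u⁻¹, .inl (isConj_iff.2 ⟨u, rfl⟩), by simp⟩
  · exact ⟨u * a⁻¹ * u⁻¹, .inr (isConj_iff.2 ⟨u, rfl⟩), by simp⟩

theorem mem_of_mem_signedConjugates {K : Subgroup G} (hK : K.Normal) {a g : G} (ha : a ∈ K)
    (hg : g ∈ signedConjugates a) : g ∈ K := by
  rcases hg with hg | hg <;> obtain ⟨u, rfl⟩ := isConj_iff.1 hg
  exacts [hK.conj_mem _ ha u, hK.conj_mem _ (inv_mem ha) u]

theorem eq_top_of_normal_of_subset_signedConjugates {S : Set G} (hS : Subgroup.closure S = ⊤)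
    {a : G} (hSa : S ⊆ signedConjugates a) {K : Subgroup G} (hK : K.Normal) (ha : a ∈ K) :
    K = ⊤ :=
  top_unique (hS ▸ (Subgroup.closure_le K).2 fun _ hs => mem_of_mem_signedConjugates hK ha (hSa hs))

theorem zpowers_eq_top_of_commute {S : Set G} (hS : Subgroup.closure S = ⊤)
    {a : G} (hSa : S ⊆ signedConjugates a) (hcomm : ∀ x y : G, Commute x y) :
    Subgroup.zpowers a = ⊤ :=
  eq_top_of_normal_of_subset_signedConjugates hS hSa
    ⟨fun n hn g => by rwa [(hcomm g n).eq, mul_inv_cancel_right]⟩ (Subgroup.mem_zpowers a)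

end SignedConjugates

section FourMoveGroups

variable {G : Type*} [Group G]

theorem mul_sq_eq_mul_sq_iff_commute {x y : G} :
    (x * y) ^ 2 = (y * x) ^ 2 ↔ Commute x (y * x * y) := by
  simp only [commute_iff_eq, pow_two, mul_assoc]

theorem commute_sq_sq {x y : G} (h : (x * y) ^ 2 = (y * x) ^ 2)
    (h' : (x * y⁻¹) ^ 2 = (y⁻¹ * x) ^ 2) : Commute (x ^ 2) (y ^ 2) := by
  rw [mul_sq_eq_mul_sq_iff_commute] at h h'
  have hx : Commute (y⁻¹ * x ^ 2 * y) x := by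
    rw [show y⁻¹ * x ^ 2 * y = y⁻¹ * x * y⁻¹ * (y * x * y) by
      rw [pow_two]; group]
    exact (h'.mul_right h).symm
  have hw : Commute (x ^ 2) (y * x * y⁻¹) := by
    simpa [mul_assoc] using (Commute.conj_iff y).2 hx
  have hy : y ^ 2 * x * (y ^ 2)⁻¹ = (y * x * y⁻¹)⁻¹ * x * (y * x * y⁻¹) := by
    rw [mul_inv_eq_iff_eq_mul, ← mul_right_inj (y * x * y⁻¹)]
    simpa [pow_two, mul_assoc] using h.eq.symm
  have hyy : y ^ 2 * x ^ 2 * (y ^ 2)⁻¹ = x ^ 2 := calc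
    _ = ((y * x * y⁻¹)⁻¹ * x * (y * x * y⁻¹)) ^ 2 := by rw [← conj_pow, hy]
    _ = (y * x * y⁻¹)⁻¹ * x ^ 2 * (y * x * y⁻¹) := by
      simpa only [inv_inv] using conj_pow (a := (y * x * y⁻¹)⁻¹) (b := x) (i := 2)
    _ = x ^ 2 := by rw [mul_assoc, hw.eq, inv_mul_cancel_left]
  exact (mul_inv_eq_iff_eq_mul.1 hyy).symm

theorem mul_self_eq_one_of_isConj {a b : G} (hab : IsConj a b) (ha : a * a = 1) : b * b = 1 := by
  obtain ⟨u, rfl⟩ := isConj_iff.1 hab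
  rw [conj_mul, ha, mul_one, mul_inv_cancel]

theorem semiconjBy_mul_zpow {b c : G} (hb : b * b = 1) (hc : c * c = 1) (k : ℤ) :
    SemiconjBy b ((b * c) ^ k) ((b * c) ^ (-k)) := by
  have hinvert : SemiconjBy b (b * c) (b * c)⁻¹ := by
    rw [SemiconjBy, mul_inv_rev, inv_eq_of_mul_eq_one_left hc, mul_assoc c,
      inv_mul_cancel, ← mul_assoc, hb, one_mul, mul_one]
  rw [zpow_neg, ← inv_zpow]
  exact hinvert.zpow_right k

theorem isConj_zpow_mul {b c : G} (hb : b * b = 1) (hc : c * c = 1) (i : ℤ) :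
    IsConj b ((b * c) ^ i * b) ∨ IsConj c ((b * c) ^ i * b) := by
  have hzpow (k : ℤ) : b * (b * c) ^ (-k) = (b * c) ^ k * b := by
    simpa only [neg_neg] using (semiconjBy_mul_zpow hb hc (-k)).eq
  obtain ⟨k, rfl | rfl⟩ := Int.even_or_odd' i
  · refine .inl (isConj_iff.2 ⟨(b * c) ^ k, ?_⟩)
    rw [mul_assoc, ← zpow_neg, hzpow, ← mul_assoc, ← zpow_add, two_mul]
  · refine .inr (isConj_iff.2 ⟨(b * c) ^ (k + 1), ?_⟩)
    calc (b * c) ^ (k + 1) * c * ((b * c) ^ (k + 1))⁻¹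
        = (b * c) ^ (k + 1) * (b * (b * c) * (b * c) ^ (-(k + 1))) := by
          rw [← mul_assoc b b c, hb, one_mul, zpow_neg, mul_assoc]
      _ = (b * c) ^ (k + 1) * (b * (b * c) ^ (-k)) := by
          rw [mul_assoc b (b * c), ← zpow_one_add]
          ring_nf
      _ = (b * c) ^ (2 * k + 1) * b := by
          rw [hzpow, ← mul_assoc, ← zpow_add]
          ring_nf

open Pointwise in
theorem commute_of_conj_mul_mem_normalizer {a b c : G} (hab : IsConj a b) (hac : IsConj a c)
    (hgen : Subgroup.closure {a, b, c} = ⊤) (hb : b * b = 1) (hc : c * c = 1) {E : Subgroup G}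
    (haE : a ∈ E) (hE : b * c ∈ Subgroup.normalizer (E : Set G))
    (hcomm : ∀ x ∈ E, ∀ y ∈ E, Commute x (b * y * b⁻¹)) (x y : G) : Commute x y := by
  have mem_normalizer_iff {K : Subgroup G} {g : G} :
      g ∈ Subgroup.normalizer (K : Set G) ↔ MulAut.conj g • K = K :=
    Subgroup.mem_normalizer_iff_map_conj_eq
  have hsub : ({a, b, c} : Set G) ⊆ signedConjugates a := by
    rintro _ (rfl | rfl | rfl)
    exacts [.inl (.refl _), .inl hab, .inl hac]
  have hmul (g h : G) (K : Subgroup G) :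
      MulAut.conj g • MulAut.conj h • K = MulAut.conj (g * h) • K := by rw [smul_smul, map_mul]
  set F := MulAut.conj b • E with hF
  have hbF : MulAut.conj b • F = E := by rw [hF, hmul, hb, map_one, one_smul]
  have hcE : MulAut.conj c • E = F := by
    rw [show c = b * (b * c) by rw [← mul_assoc, hb, one_mul], ← hmul, mem_normalizer_iff.1 hE]
  have hcF : MulAut.conj c • F = E := by rw [← hcE, hmul, hc, map_one, one_smul]
  have hsup : (E ⊔ F).Normal := by
    rw [← Subgroup.normalizer_eq_top_iff, eq_top_iff, ← hgen, Subgroup.closure_le]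
    rintro _ (rfl | rfl | rfl)
    · exact Subgroup.le_normalizer (le_sup_left (a := E) haE)
    · exact mem_normalizer_iff.2 (by rw [Subgroup.smul_sup, hbF, ← hF, sup_comm])
    · exact mem_normalizer_iff.2 (by rw [Subgroup.smul_sup, hcF, hcE, sup_comm])
  have hnormal : E.Normal := by
    rw [← Subgroup.normalizer_eq_top_iff, eq_top_iff,
      ← eq_top_of_normal_of_subset_signedConjugates hgen hsub hsup (le_sup_left (a := E) haE)]
    refine sup_le Subgroup.le_normalizer
      (le_trans (fun z hz => ?_) (Subgroup.centralizer_le_normalizer (E : Set G)))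
    obtain ⟨y, hy, rfl⟩ := Subgroup.mem_smul_pointwise_iff_exists _ _ _ |>.1 hz
    exact Subgroup.mem_centralizer_iff.2 fun x hx => (hcomm x hx y hy).eq
  have htop : E = ⊤ := eq_top_of_normal_of_subset_signedConjugates hgen hsub hnormal haE
  simpa [mul_assoc] using
    hcomm x (htop ▸ Subgroup.mem_top x) (b⁻¹ * y * b) (htop ▸ Subgroup.mem_top _)

theorem commute_conj_zpow {a b c : G} (hb : b * b = 1) (hc : c * c = 1)
    (hcomm : ∀ s, IsConj b s ∨ IsConj c s → Commute a (s * a * s⁻¹)) (i j : ℤ) :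
    Commute ((b * c) ^ i * a * ((b * c) ^ i)⁻¹)
      (b * ((b * c) ^ j * a * ((b * c) ^ j)⁻¹) * b⁻¹) := by
  have conj_conj (g h : G) : g * (h * a * h⁻¹) * g⁻¹ = g * h * a * (g * h)⁻¹ := by
    simp only [mul_inv_rev, mul_assoc]
  have hbr : b * (b * c) ^ j = (b * c) ^ i * ((b * c) ^ (-i - j) * b) := by
    rw [(semiconjBy_mul_zpow hb hc j).eq, ← mul_assoc, ← zpow_add]
    congr 2
    ring
  have hconj := (Commute.conj_iff ((b * c) ^ i)).2 (hcomm _ (isConj_zpow_mul hb hc (-i - j)))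
  rwa [conj_conj, ← hbr, ← conj_conj] at hconj

theorem commute_of_involutions {a b c : G} (hab : IsConj a b) (hac : IsConj a c)
    (hgen : Subgroup.closure {a, b, c} = ⊤) (ha : a * a = 1)
    (hfour : ∀ x ∈ conjugatesOf a, ∀ y ∈ conjugatesOf a, (x * y) ^ 2 = (y * x) ^ 2) (x y : G) :
    Commute x y := by
  have hinvol {x : G} (hx : IsConj a x) : x * x = 1 := mul_self_eq_one_of_isConj hx ha
  have hcomm_conj {s : G} (hs : IsConj a s) : Commute a (s * a * s⁻¹) := by
    rw [inv_eq_of_mul_eq_one_left (hinvol hs), ← mul_sq_eq_mul_sq_iff_commute]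
    exact hfour a (.refl a) s hs
  set r := b * c
  let conjugates : Set G := Set.range fun i : ℤ => r ^ i * a * (r ^ i)⁻¹
  have hcomm : ∀ x ∈ Subgroup.closure conjugates, ∀ y ∈ Subgroup.closure conjugates,
      Commute x (b * y * b⁻¹) := by
    intro x hx y hy
    induction hx, hy using Subgroup.closure_induction₂ with
    | mem x y hx hy =>
      obtain ⟨i, rfl⟩ := hx
      obtain ⟨j, rfl⟩ := hy
      exact commute_conj_zpow (hinvol hab) (hinvol hac)
        (fun s hs => hcomm_conj (hs.elim hab.trans hac.trans)) i j
    | one_left x _ => simp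
    | one_right x _ => simp
    | mul_left x y z _ _ _ h h' => exact h.mul_left h'
    | mul_right y z x _ _ _ h h' => rw [← conj_mul]; exact h.mul_right h'
    | inv_left x y _ _ h => exact h.inv_left
    | inv_right x y _ _ h => rw [← conj_inv]; exact h.inv_right
  have hr : r ∈ Subgroup.normalizer conjugates := by
    rw [Subgroup.mem_normalizer_iff_conj_image_eq, ← Set.range_comp]
    refine Eq.trans (congrArg Set.range (funext fun i => ?_))
      ((Equiv.addLeft (1 : ℤ)).surjective.range_comp fun i => r ^ i * a * (r ^ i)⁻¹)
    simp [zpow_one_add, mul_assoc]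
  have haE : a ∈ conjugates := ⟨0, by simp⟩
  exact commute_of_conj_mul_mem_normalizer hab hac hgen (hinvol hab) (hinvol hac)
    (Subgroup.subset_closure haE) (Subgroup.normalizer_le_normalizer_closure _ hr)
    hcomm x y

theorem signedConjugates_eq_conjugatesOf {a : G} (ha : a * a = 1) :
    signedConjugates a = conjugatesOf a := by
  simp [signedConjugates, conjugatesOf, inv_eq_of_mul_eq_one_left ha]

theorem commute_of_fourMove_of_sq_eq_one {x a b c : G} (hx : x * x = 1)
    (hgen : Subgroup.closure {a, b, c} = ⊤) (habc : {a, b, c} ⊆ signedConjugates x)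
    (hfour : ∀ y ∈ signedConjugates x, ∀ z ∈ signedConjugates x, (y * z) ^ 2 = (z * y) ^ 2)
    (y z : G) : Commute y z := by
  simp only [signedConjugates_eq_conjugatesOf hx, Set.insert_subset_iff,
    Set.singleton_subset_iff] at habc hfour
  obtain ⟨ha, hb, hc⟩ := habc
  rw [IsConj.conjugatesOf_eq ha] at hfour
  exact commute_of_involutions (ha.symm.trans hb) (ha.symm.trans hc) hgen
    (mul_self_eq_one_of_isConj ha hx) hfour y z

theorem normalClosure_sq_le_center {x : G}
    (hfour : ∀ y ∈ signedConjugates x, ∀ z ∈ signedConjugates x, (y * z) ^ 2 = (z * y) ^ 2)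
    (hx : Subgroup.zpowers x ⊔ Subgroup.normalClosure {x ^ 2} = ⊤) :
    Subgroup.normalClosure {x ^ 2} ≤ Subgroup.center G := by
  refine Subgroup.normalClosure_le_normal (Subgroup.centralizer_eq_top_iff_subset.1 ?_)
  rw [eq_top_iff, ← hx, sup_le_iff, Subgroup.zpowers_le, Subgroup.normalClosure,
    Subgroup.closure_le]
  constructor
  · exact Subgroup.mem_centralizer_singleton_iff.2 (pow_mul_comm' x 2).symm
  · intro y hy
    obtain ⟨_, rfl, hy⟩ := Group.mem_conjugatesOfSet_iff.1 hy
    obtain ⟨u, rfl⟩ := isConj_iff.1 hy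
    have hu : u * x * u⁻¹ ∈ signedConjugates x := .inl (isConj_iff.2 ⟨u, rfl⟩)
    have hcomm := commute_sq_sq (hfour _ hu x (mem_signedConjugates_self x))
      (hfour _ hu _ (inv_mem_signedConjugates (mem_signedConjugates_self x)))
    rw [conj_pow] at hcomm
    exact Subgroup.mem_centralizer_singleton_iff.2 hcomm

theorem zpowers_eq_top_of_fourMove {x a b c : G}
    (hgen : Subgroup.closure {a, b, c} = ⊤) (habc : {a, b, c} ⊆ signedConjugates x)
    (hfour : ∀ y ∈ signedConjugates x, ∀ z ∈ signedConjugates x, (y * z) ^ 2 = (z * y) ^ 2) :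
    Subgroup.zpowers x = ⊤ := by
  set N := Subgroup.normalClosure {x ^ 2}
  let π := QuotientGroup.mk' N
  have hπ : Function.Surjective π := QuotientGroup.mk'_surjective N
  have hgenπ : Subgroup.closure {π a, π b, π c} = ⊤ := by
    rw [← Subgroup.map_top_of_surjective π hπ, ← hgen, MonoidHom.map_closure,
      Set.image_insert_eq, Set.image_pair]
  have habcπ : {π a, π b, π c} ⊆ signedConjugates (π x) := by
    rw [← Set.image_pair, ← Set.image_insert_eq, Set.image_subset_iff]
    exact fun g hg => map_mem_signedConjugates π (habc hg)
  have hcommπ : ∀ y z : G ⧸ N, Commute y z := by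
    refine commute_of_fourMove_of_sq_eq_one (x := π x) ?_ hgenπ habcπ fun _ hy _ hz => ?_
    · rw [← pow_two, ← map_pow]
      exact (QuotientGroup.eq_one_iff _).2 (Subgroup.subset_normalClosure rfl)
    · obtain ⟨y, hy', rfl⟩ := exists_signedConjugates_map_eq hπ hy
      obtain ⟨z, hz', rfl⟩ := exists_signedConjugates_map_eq hπ hz
      rw [← map_mul, ← map_mul, ← map_pow, ← map_pow, hfour y hy' z hz']
  have hcyclic : Subgroup.zpowers (π x) = ⊤ := zpowers_eq_top_of_commute hgenπ habcπ hcommπ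
  have hsup : Subgroup.zpowers x ⊔ N = ⊤ := by
    rw [← QuotientGroup.ker_mk' N, ← Subgroup.comap_map_eq, MonoidHom.map_zpowers, hcyclic,
      Subgroup.comap_top]
  have : IsCyclic (G ⧸ N) := ⟨π x, fun y => (Subgroup.eq_top_iff' _).1 hcyclic y⟩
  have hcomm := π.isMulCommutative_of_isCyclic_of_ker_le_center
    ((QuotientGroup.ker_mk' N).trans_le (normalClosure_sq_le_center hfour hsup))
  exact zpowers_eq_top_of_commute hgen habc hcomm.is_comm.comm

theorem nonempty_mulEquiv_zmod {n : ℕ} {a : G}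
    (ha : Subgroup.zpowers a = ⊤) (han : a ^ n = 1) (f : G →* Multiplicative (ZMod n))
    (hf : f a = Multiplicative.ofAdd 1) : Nonempty (G ≃* Multiplicative (ZMod n)) := by
  have hzpow (k : ℤ) : f (a ^ k) = Multiplicative.ofAdd (k : ZMod n) := by
    rw [map_zpow, hf, ← ofAdd_zsmul, zsmul_one]
  refine ⟨MulEquiv.ofBijective f ⟨(injective_iff_map_eq_one f).2 fun g hg => ?_, fun y => ?_⟩⟩
  · obtain ⟨k, rfl⟩ := Subgroup.mem_zpowers_iff.1 (ha ▸ Subgroup.mem_top g)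
    rw [hzpow, ofAdd_eq_one, ZMod.intCast_zmod_eq_zero_iff_dvd] at hg
    obtain ⟨l, rfl⟩ := hg
    rw [zpow_mul, zpow_natCast, han, one_zpow]
  · exact ⟨a ^ (y.toAdd.cast : ℤ), by simp [hzpow]⟩

end FourMoveGroups

/-! ### Colorings of Gauss words -/

section Colorings

variable {G : Type*} [Group G]

/-- The Wirtinger rule: the color of a strand colored `x` after it has passed under a strand
colored `z`, at a crossing that is positive iff `pos` is true. -/
def undercross (pos : Bool) (z x : G) : G :=
  if pos then z⁻¹ * x * z else z * x * z⁻¹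

theorem isConj_undercross (pos : Bool) (z x : G) : IsConj x (undercross pos z x) := by
  cases pos
  · exact isConj_iff.2 ⟨z, rfl⟩
  · exact isConj_iff.2 ⟨z⁻¹, by simp [undercross]⟩

theorem undercross_mem_iff {H : Subgroup G} {pos : Bool} {z x : G} (hz : z ∈ H) :
    undercross pos z x ∈ H ↔ x ∈ H := by
  cases pos
  · simp [undercross, H.mul_mem_cancel_right, H.mul_mem_cancel_left, hz]
  · simp [undercross, H.mul_mem_cancel_right, H.mul_mem_cancel_left, hz]

theorem undercross_eq_self_iff {pos : Bool} {z x : G} : undercross pos z x = z ↔ x = z := by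
  cases pos
  · simp [undercross, mul_inv_eq_iff_eq_mul]
  · simp [undercross, mul_assoc, inv_mul_eq_iff_eq_mul]

theorem undercross_not_undercross (pos : Bool) (z x : G) :
    undercross (!pos) z (undercross pos z x) = x := by
  cases pos <;> simp [undercross, mul_assoc]

theorem undercross_undercross (p q : Bool) (z y x : G) :
    undercross p z (undercross q y x) = undercross q (undercross p z y) (undercross p z x) := by
  cases p <;> cases q <;> simp [undercross, mul_assoc]

/-- A passage `p` takes the color `x` to the color `y` if the over-strand at the crossing `k` is
colored `h k`. -/
def Passes (h : ℕ → G) (p : Passage) (x y : G) : Prop :=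
  if p.isOver then h p.label = x ∧ x = y else undercross p.isPos (h p.label) x = y

theorem Passes.isConj {h : ℕ → G} {p : Passage} {x y : G} (hp : Passes h p x y) : IsConj x y := by
  unfold Passes at hp
  split_ifs at hp
  · exact hp.2 ▸ .refl x
  · exact hp ▸ isConj_undercross _ _ _

theorem Passes.mem_iff {h : ℕ → G} {p : Passage} {x y : G} (hp : Passes h p x y) {H : Subgroup G}
    (hH : h p.label ∈ H) : y ∈ H ↔ x ∈ H := by
  unfold Passes at hp
  split_ifs at hp
  · rw [hp.2]
  · rw [← hp, undercross_mem_iff hH]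

/-- The relation between the colors before and after the knot has run through the passages of a
word, given the colors of the over-strands. -/
def transport (h : ℕ → G) : GaussWord → G → G → Prop
  | [] => Eq
  | p :: w => Relation.Comp (Passes h p) (transport h w)

theorem transport_append (h : ℕ → G) (v w : GaussWord) :
    transport h (v ++ w) = Relation.Comp (transport h v) (transport h w) := by
  induction v with
  | nil => exact Relation.eq_comp.symm
  | cons p v ih => rw [List.cons_append, transport, transport, ih, Relation.comp_assoc]

theorem transport_append_iff {h : ℕ → G} {v w : GaussWord} {x y : G} :
    transport h (v ++ w) x y ↔ ∃ z, transport h v x z ∧ transport h w z y := by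
  rw [transport_append, Relation.Comp]

theorem transport_pair_iff {h : ℕ → G} {p q : Passage} {x y : G} :
    transport h [p, q] x y ↔ ∃ z, Passes h p x z ∧ Passes h q z y := by
  simp [transport, Relation.Comp]

theorem transport_congr {h h' : ℕ → G} {w : GaussWord} (hw : ∀ p ∈ w, h p.label = h' p.label) :
    transport h w = transport h' w := by
  induction w with
  | nil => rfl
  | cons p w ih =>
    rw [List.forall_mem_cons] at hw
    have hp : Passes h p = Passes h' p := by
      unfold Passes
      rw [hw.1]
    rw [transport, transport, hp, ih hw.2]

theorem transport_update_of_forall_ne {h : ℕ → G} {k : ℕ} {w : GaussWord}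
    (hw : ∀ p ∈ w, p.label ≠ k) (g : G) :
    transport (Function.update h k g) w = transport h w :=
  transport_congr fun p hp => Function.update_of_ne (hw p hp) g h

theorem transport_map_relabel (h : ℕ → G) (σ : ℕ → ℕ) (w : GaussWord) :
    transport h (w.map fun p => ⟨σ p.label, p.isOver, p.isPos⟩) = transport (h ∘ σ) w := by
  induction w with
  | nil => rfl
  | cons p w ih =>
    rw [List.map_cons, transport, transport, ih]
    rfl

/-- A coloring of the edges `0, …, length` cut out by the passages of a word, given the colors
of the over-strands. -/
def IsEdgeColoring (w : GaussWord) (h : ℕ → G) (f : Fin (w.length + 1) → G) : Prop :=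
  ∀ i, Passes h (w.get i) (f i.castSucc) (f i.succ)

theorem transport_iff_exists_isEdgeColoring {h : ℕ → G} {w : GaussWord} {x y : G} :
    transport h w x y ↔ ∃ f, IsEdgeColoring w h f ∧ f 0 = x ∧ f (Fin.last _) = y := by
  induction w generalizing x with
  | nil =>
    refine ⟨fun hxy => ⟨fun _ => x, fun i => i.elim0, rfl, hxy⟩, ?_⟩
    rintro ⟨f, -, rfl, rfl⟩
    rfl
  | cons p w ih =>
    simp only [transport, Relation.Comp, ih]
    constructor
    · rintro ⟨z, hp, f, hf, rfl, rfl⟩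
      refine ⟨Fin.cons x f, Fin.cases hp hf, rfl, rfl⟩
    · rintro ⟨f, hf, rfl, rfl⟩
      exact ⟨f 1, hf 0, Fin.tail f, fun i => hf i.succ, rfl, rfl⟩

namespace IsEdgeColoring

variable {w : GaussWord} {h : ℕ → G} {f : Fin (w.length + 1) → G}

theorem isConj (hf : IsEdgeColoring w h f) (e : Fin (w.length + 1)) : IsConj (f 0) (f e) := by
  induction e using Fin.induction with
  | zero => exact .refl _
  | succ i ih => exact ih.trans (hf i).isConj

theorem mem_iff (hf : IsEdgeColoring w h f) {H : Subgroup G} (hH : ∀ p ∈ w, h p.label ∈ H)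
    (e : Fin (w.length + 1)) : f e ∈ H ↔ f 0 ∈ H := by
  induction e using Fin.induction with
  | zero => rfl
  | succ i ih => rw [(hf i).mem_iff (hH _ (w.get_mem i)), ih]

end IsEdgeColoring

theorem transport.isConj {h : ℕ → G} {w : GaussWord} {x y : G} (hw : transport h w x y) :
    IsConj x y := by
  obtain ⟨f, hf, rfl, rfl⟩ := transport_iff_exists_isEdgeColoring.1 hw
  exact hf.isConj _

theorem transport.mem_iff {h : ℕ → G} {w : GaussWord} {x y : G} (hw : transport h w x y)
    {H : Subgroup G} (hH : ∀ p ∈ w, h p.label ∈ H) : y ∈ H ↔ x ∈ H := by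
  obtain ⟨f, hf, rfl, rfl⟩ := transport_iff_exists_isEdgeColoring.1 hw
  exact hf.mem_iff hH _

/-- A coloring of a Gauss word by a group, encoded by the color `g` of the strand at the base
point and the colors `h k` of the over-strands at the crossings `k`. -/
def IsColoring (w : GaussWord) (h : ℕ → G) (g : G) : Prop :=
  transport h w g g

/-- The subgroup generated by the colors of the over-strands and of the strand at the base
point. -/
def colorGroup (w : GaussWord) (h : ℕ → G) (g : G) : Subgroup G :=
  Subgroup.closure (insert g ((fun p => h p.label) '' {p | p ∈ w}))

theorem colorGroup_le_iff {w : GaussWord} {h : ℕ → G} {g : G} {H : Subgroup G} :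
    colorGroup w h g ≤ H ↔ g ∈ H ∧ ∀ p ∈ w, h p.label ∈ H := by
  simp [colorGroup, Set.subset_def]

theorem base_mem_colorGroup (w : GaussWord) (h : ℕ → G) (g : G) : g ∈ colorGroup w h g :=
  (colorGroup_le_iff.1 le_rfl).1

theorem label_mem_colorGroup {w : GaussWord} {p : Passage} (hp : p ∈ w) (h : ℕ → G) (g : G) :
    h p.label ∈ colorGroup w h g :=
  (colorGroup_le_iff.1 le_rfl).2 p hp

theorem colorGroup_mono {v w : GaussWord} (hvw : ∀ p ∈ v, p ∈ w) (h : ℕ → G) (g : G) :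
    colorGroup v h g ≤ colorGroup w h g :=
  Subgroup.closure_mono (Set.insert_subset_insert (Set.image_mono hvw))

theorem colorGroup_congr {h h' : ℕ → G} {w : GaussWord} (hw : ∀ p ∈ w, h p.label = h' p.label)
    (g : G) : colorGroup w h g = colorGroup w h' g := by
  have himage : (fun p => h p.label) '' {p | p ∈ w} = (fun p => h' p.label) '' {p | p ∈ w} :=
    Set.image_congr hw
  rw [colorGroup, colorGroup, himage]

end Colorings

/-! ### Reidemeister moves -/

namespace GaussWord.IsCode

theorem perm {v w : GaussWord} (hv : v.IsCode) (h : v.Perm w) : w.IsCode :=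
  ⟨h.nodup hv.1, fun p hp => h.mem_iff.1 (hv.2.1 p (h.mem_iff.2 hp)),
    fun p hp q hq => hv.2.2 p (h.mem_iff.2 hp) q (h.mem_iff.2 hq)⟩

theorem eq_or_eq_partner {w : GaussWord} (hw : w.IsCode) {p q : Passage} (hp : p ∈ w)
    (hq : q ∈ w) (hpq : q.label = p.label) : q = p ∨ q = p.partner := by
  have hsign := hw.2.2 q hq p hp hpq
  obtain ⟨l, o, s⟩ := p
  obtain ⟨l', o', s'⟩ := q
  obtain rfl : l' = l := hpq
  obtain rfl : s' = s := hsign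
  cases o <;> cases o' <;> simp [Passage.partner]

theorem label_ne_of_mem_append {u v : GaussWord} (hw : GaussWord.IsCode (u ++ v)) {p : Passage}
    (hp : p ∈ u) (hp' : p.partner ∈ u) : ∀ q ∈ v, q.label ≠ p.label := by
  intro q hq hqp
  have hdisj := List.disjoint_of_nodup_append hw.1
  rcases hw.eq_or_eq_partner (List.mem_append_left _ hp) (List.mem_append_right _ hq) hqp
    with rfl | rfl
  exacts [hdisj hp hq, hdisj hp' hq]

theorem label_ne_of_ne {w : GaussWord} (hw : w.IsCode) {p q : Passage} (hp : p ∈ w) (hq : q ∈ w)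
    (hpq : q ≠ p) (hover : q.isOver = p.isOver) : q.label ≠ p.label := by
  intro h
  rcases hw.eq_or_eq_partner hp hq h with rfl | rfl
  · exact hpq rfl
  · simp [Passage.partner] at hover

end GaussWord.IsCode

theorem strand_perm (d : Bool) (p q : Passage) : (strand d p q).Perm [p, q] := by
  cases d
  exacts [List.Perm.swap .., List.Perm.refl _]

theorem mem_strand {d : Bool} {p q r : Passage} : r ∈ strand d p q ↔ r = p ∨ r = q := by
  simp [(strand_perm d p q).mem_iff]

section Moves

variable {G : Type*} [Group G]

theorem transport_kink_iff {h : ℕ → G} {k : ℕ} {o s : Bool} {x y : G} :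
    transport h [⟨k, o, s⟩, ⟨k, !o, s⟩] x y ↔ h k = x ∧ x = y := by
  have hself : undercross s (h k) (h k) = h k := undercross_eq_self_iff.2 rfl
  cases o
  · simp only [transport_pair_iff, Passes, Bool.not_false, if_true, Bool.false_eq_true, if_false,
      exists_eq_left', eq_comm (a := h k), undercross_eq_self_iff]
    grind
  · simp only [transport_pair_iff, Passes, Bool.not_true, if_true, Bool.false_eq_true, if_false]
    grind

theorem transport_over_pair_iff {h : ℕ → G} {d s t : Bool} {k l : ℕ} {x y : G} :
    transport h (strand d ⟨k, true, s⟩ ⟨l, true, t⟩) x y ↔ (h k = x ∧ h l = x) ∧ x = y := by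
  cases d <;> simp [strand, transport_pair_iff, Passes] <;> grind

theorem transport_under_pair_iff {h : ℕ → G} {d s : Bool} {k l : ℕ} (hkl : h k = h l) {x y : G} :
    transport h (strand d ⟨k, false, s⟩ ⟨l, false, !s⟩) x y ↔ x = y := by
  have hnot (z x : G) : undercross s z (undercross (!s) z x) = x := by
    simpa using undercross_not_undercross (!s) z x
  cases d <;> simp [strand, transport_pair_iff, Passes, hkl, hnot, undercross_not_undercross]

theorem transport_second_iff {h : ℕ → G} {k l : ℕ} {o s d : Bool} {A B : GaussWord} {x y : G} :
    transport h ([⟨k, o, s⟩, ⟨l, o, !s⟩] ++ A ++ strand d ⟨k, !o, s⟩ ⟨l, !o, !s⟩ ++ B) x y ↔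
      ∃ z, (transport h A x z ∧ transport h B z y) ∧
        h k = (if o then x else z) ∧ h l = if o then x else z := by
  rw [show [⟨k, o, s⟩, ⟨l, o, !s⟩] = strand true ⟨k, o, s⟩ ⟨l, o, !s⟩ from rfl]
  simp only [transport_append_iff]
  cases o
  · simp only [Bool.not_false, transport_over_pair_iff]
    constructor
    · rintro ⟨_, ⟨z, ⟨_, hunder, hA⟩, ⟨hk, hl⟩, rfl⟩, hB⟩
      obtain rfl := (transport_under_pair_iff (hk.trans hl.symm)).1 hunder
      exact ⟨z, ⟨hA, hB⟩, hk, hl⟩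
    · rintro ⟨z, ⟨hA, hB⟩, hk, hl⟩
      exact ⟨z, ⟨z, ⟨x, (transport_under_pair_iff (hk.trans hl.symm)).2 rfl, hA⟩, ⟨hk, hl⟩, rfl⟩,
        hB⟩
  · simp only [Bool.not_true, transport_over_pair_iff]
    constructor
    · rintro ⟨_, ⟨z, ⟨_, ⟨⟨hk, hl⟩, rfl⟩, hA⟩, hunder⟩, hB⟩
      obtain rfl := (transport_under_pair_iff (hk.trans hl.symm)).1 hunder
      exact ⟨z, ⟨hA, hB⟩, hk, hl⟩
    · rintro ⟨z, ⟨hA, hB⟩, hk, hl⟩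
      exact ⟨z, ⟨z, ⟨x, ⟨⟨hk, hl⟩, rfl⟩, hA⟩, (transport_under_pair_iff (hk.trans hl.symm)).2 rfl⟩,
        hB⟩

/-- The colors of the over-strands after a third Reidemeister move has pushed the over-strand of
the crossing `c` across the strand that passes over at `a`. -/
def slide (a c : ℕ) (pos : Bool) (h : ℕ → G) : ℕ → G :=
  Function.update h c (undercross pos (h a) (h c))

theorem slide_self (a c : ℕ) (pos : Bool) (h : ℕ → G) :
    slide a c pos h c = undercross pos (h a) (h c) :=
  Function.update_self ..

theorem slide_of_ne {k c : ℕ} (hk : k ≠ c) (a : ℕ) (pos : Bool) (h : ℕ → G) :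
    slide a c pos h k = h k :=
  Function.update_of_ne hk ..

theorem transport_slide_of_forall_ne {c : ℕ} {w : GaussWord} (hw : ∀ p ∈ w, p.label ≠ c) (a : ℕ)
    (pos : Bool) (h : ℕ → G) : transport (slide a c pos h) w = transport h w :=
  transport_update_of_forall_ne hw _

theorem transport_slide_top {a b c : ℕ} (hac : a ≠ c) (hbc : b ≠ c) (pos d s t : Bool)
    (h : ℕ → G) :
    transport (slide a c pos h) (strand (!d) ⟨a, true, s⟩ ⟨b, true, t⟩) =
      transport h (strand d ⟨a, true, s⟩ ⟨b, true, t⟩) := by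
  ext x y
  rw [transport_over_pair_iff, transport_over_pair_iff, slide_of_ne hac, slide_of_ne hbc]

theorem transport_slide_middle {a c : ℕ} (hac : a ≠ c) (s t d : Bool) (h : ℕ → G) :
    transport (slide a c (s ^^ d) h) (strand (!d) ⟨a, false, s⟩ ⟨c, true, t⟩) =
      transport h (strand d ⟨a, false, s⟩ ⟨c, true, t⟩) := by
  ext x y
  have hleft := undercross_not_undercross s (h a)
  have hright : ∀ z, undercross s (h a) (undercross (!s) (h a) z) = z := by
    simpa using undercross_not_undercross (!s) (h a)
  cases d <;>
    simp only [strand, Bool.not_true, Bool.not_false, if_true, if_false, Bool.false_eq_true,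
      transport_pair_iff, Passes, slide_self, slide_of_ne hac, Bool.xor_true, Bool.xor_false] <;>
    grind

theorem transport_slide_bottom {a b c : ℕ} {h : ℕ → G} (hbc : b ≠ c) (hab : h a = h b)
    (pos t d : Bool) :
    transport (slide a c pos h) (strand (!d) ⟨b, false, pos ^^ d⟩ ⟨c, false, t⟩) =
      transport h (strand d ⟨b, false, pos ^^ d⟩ ⟨c, false, t⟩) := by
  ext x y
  cases d
  · simp [strand, transport_pair_iff, Passes, slide_self, slide_of_ne hbc, hab,
      undercross_undercross pos t]
  · simp [strand, transport_pair_iff, Passes, slide_self, slide_of_ne hbc, hab,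
      undercross_undercross (!pos) t, undercross_not_undercross]

/-- Every coloring of `v` by `G` gives rise to a coloring of `w` with a conjugate color at the
base point, whose colors generate at least as large a subgroup. -/
def ColoringTransfer (G : Type*) [Group G] (v w : GaussWord) : Prop :=
  ∀ (h : ℕ → G) (g : G), IsColoring v h g →
    ∃ h' g', IsColoring w h' g' ∧ IsConj g g' ∧ colorGroup v h g ≤ colorGroup w h' g'

namespace ColoringTransfer

theorem rotate (A B : GaussWord) : ColoringTransfer G (A ++ B) (B ++ A) := by
  intro h g hg
  obtain ⟨m, hA, hB⟩ := transport_append_iff.1 hg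
  refine ⟨h, m, transport_append_iff.2 ⟨g, hB, hA⟩, hA.isConj, colorGroup_le_iff.2 ⟨?_, ?_⟩⟩
  · exact (hA.mem_iff fun p hp => label_mem_colorGroup (List.mem_append_right _ hp) h m).1
      (base_mem_colorGroup _ h m)
  · exact fun p hp => label_mem_colorGroup (List.perm_append_comm.mem_iff.1 hp) h m

theorem relabel (σ : Equiv.Perm ℕ) (w : GaussWord) :
    ColoringTransfer G w (w.map fun p => ⟨σ p.label, p.isOver, p.isPos⟩) := by
  intro h g hg
  refine ⟨h ∘ σ.symm, g, ?_, .refl g, colorGroup_le_iff.2 ⟨base_mem_colorGroup _ _ g, ?_⟩⟩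
  · rw [IsColoring, transport_map_relabel, Function.comp_assoc, σ.symm_comp_self]
    exact hg
  · intro p hp
    simpa using label_mem_colorGroup
      (List.mem_map_of_mem (f := fun p : Passage => ⟨σ p.label, p.isOver, p.isPos⟩) hp)
      (h ∘ σ.symm) g

theorem relabel_symm (σ : Equiv.Perm ℕ) (w : GaussWord) :
    ColoringTransfer G (w.map fun p => ⟨σ p.label, p.isOver, p.isPos⟩) w := by
  intro h g hg
  rw [IsColoring, transport_map_relabel] at hg
  refine ⟨h ∘ σ, g, hg, .refl g,
    colorGroup_le_iff.2 ⟨base_mem_colorGroup _ _ g, List.forall_mem_map.2 fun p hp => ?_⟩⟩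
  exact label_mem_colorGroup hp (h ∘ σ) g

theorem first {k : ℕ} {o s : Bool} {A : GaussWord}
    (hcode : GaussWord.IsCode ([⟨k, o, s⟩, ⟨k, !o, s⟩] ++ A)) :
    ColoringTransfer G A ([⟨k, o, s⟩, ⟨k, !o, s⟩] ++ A) := by
  intro h g hg
  have hk : ∀ p ∈ A, p.label ≠ k :=
    hcode.label_ne_of_mem_append (p := ⟨k, o, s⟩) (by simp) (by simp [Passage.partner])
  refine ⟨Function.update h k g, g, ?_, .refl g, ?_⟩
  · refine transport_append_iff.2 ⟨g, transport_kink_iff.2 ⟨by simp, rfl⟩, ?_⟩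
    rwa [transport_update_of_forall_ne hk]
  · rw [colorGroup_congr (h' := Function.update h k g)
      fun p hp => (Function.update_of_ne (hk p hp) g h).symm]
    exact colorGroup_mono (fun p => List.mem_append_right _) _ g

theorem second {k l : ℕ} {o s d : Bool} {A B : GaussWord}
    (hcode : GaussWord.IsCode
      ([⟨k, o, s⟩, ⟨l, o, !s⟩] ++ A ++ strand d ⟨k, !o, s⟩ ⟨l, !o, !s⟩ ++ B)) :
    ColoringTransfer G (A ++ B)
      ([⟨k, o, s⟩, ⟨l, o, !s⟩] ++ A ++ strand d ⟨k, !o, s⟩ ⟨l, !o, !s⟩ ++ B) := by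
  intro h g hg
  obtain ⟨z, hA, hB⟩ := transport_append_iff.1 hg
  have hperm : List.Perm ([⟨k, o, s⟩, ⟨l, o, !s⟩] ++ A ++ strand d ⟨k, !o, s⟩ ⟨l, !o, !s⟩ ++ B)
      ([⟨k, o, s⟩, ⟨l, o, !s⟩, ⟨k, !o, s⟩, ⟨l, !o, !s⟩] ++ (A ++ B)) := by
    refine List.perm_iff_count.2 fun p => ?_
    simp only [List.count_append, (strand_perm _ _ _).count_eq, List.count_cons, List.count_nil]
    ring
  have hk : ∀ p ∈ A ++ B, p.label ≠ k :=
    (hcode.perm hperm).label_ne_of_mem_append (p := ⟨k, o, s⟩) (by simp) (by simp [Passage.partner])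
  have hl : ∀ p ∈ A ++ B, p.label ≠ l :=
    (hcode.perm hperm).label_ne_of_mem_append (p := ⟨l, o, !s⟩) (by simp)
      (by simp [Passage.partner])
  have hkl : k ≠ l := by
    rintro rfl
    exact Bool.self_ne_not s (hcode.2.2 ⟨k, o, s⟩ (by simp) ⟨k, o, !s⟩ (by simp) rfl)
  set x := if o then g else z
  set h' := Function.update (Function.update h k x) l x with hh'
  have hagree : ∀ p ∈ A ++ B, h p.label = h' p.label := fun p hp => by
    rw [hh', Function.update_of_ne (hl p hp), Function.update_of_ne (hk p hp)]
  refine ⟨h', g, transport_second_iff.2 ⟨z, ⟨?_, ?_⟩, ?_, ?_⟩, .refl g, ?_⟩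
  · rwa [← transport_congr fun p hp => hagree p (List.mem_append_left B hp)]
  · rwa [← transport_congr fun p hp => hagree p (List.mem_append_right A hp)]
  · rw [hh', Function.update_of_ne hkl, Function.update_self]
  · rw [hh', Function.update_self]
  · rw [colorGroup_congr hagree]
    refine colorGroup_mono (fun p hp => ?_) h' g
    rw [hperm.mem_iff]
    exact List.mem_append_right _ hp

theorem second_symm (k l : ℕ) (o s d : Bool) (A B : GaussWord) :
    ColoringTransfer G ([⟨k, o, s⟩, ⟨l, o, !s⟩] ++ A ++ strand d ⟨k, !o, s⟩ ⟨l, !o, !s⟩ ++ B)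
      (A ++ B) := by
  intro h g hg
  obtain ⟨z, ⟨hA, hB⟩, hk, hl⟩ := transport_second_iff.1 hg
  refine ⟨h, g, transport_append_iff.2 ⟨z, hA, hB⟩, .refl g, ?_⟩
  have hlabel : ∀ p ∈ A ++ B, h p.label ∈ colorGroup (A ++ B) h g :=
    fun p hp => label_mem_colorGroup hp h g
  have hg : g ∈ colorGroup (A ++ B) h g := base_mem_colorGroup _ h g
  have hz : z ∈ colorGroup (A ++ B) h g :=
    (hA.mem_iff fun p hp => hlabel p (List.mem_append_left B hp)).2 hg
  have hx : (if o then g else z) ∈ colorGroup (A ++ B) h g := by split_ifs <;> assumption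
  refine colorGroup_le_iff.2 ⟨hg, fun p hp => ?_⟩
  have hpmem : (p = ⟨k, o, s⟩ ∨ p = ⟨l, o, !s⟩) ∨ (p = ⟨k, !o, s⟩ ∨ p = ⟨l, !o, !s⟩) ∨
      p ∈ A ++ B := by
    simpa [mem_strand, or_assoc, or_left_comm] using hp
  rcases hpmem with (rfl | rfl) | (rfl | rfl) | hp
  exacts [hk ▸ hx, hl ▸ hx, hk ▸ hx, hl ▸ hx, hlabel p hp]

theorem first_symm (k : ℕ) (o s : Bool) (A : GaussWord) :
    ColoringTransfer G ([⟨k, o, s⟩, ⟨k, !o, s⟩] ++ A) A := by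
  intro h g hg
  obtain ⟨x, hkink, hA⟩ := transport_append_iff.1 hg
  obtain ⟨hk, rfl⟩ := transport_kink_iff.1 hkink
  refine ⟨h, g, hA, .refl g, colorGroup_le_iff.2 ⟨base_mem_colorGroup A h g, ?_⟩⟩
  have hkg : h k ∈ colorGroup A h g := hk ▸ base_mem_colorGroup A h g
  simpa [hkg] using fun p hp => label_mem_colorGroup hp h g

theorem of_slide {v w : GaussWord} {p q : Passage} (hp : p ∈ w) (hq : q ∈ w)
    (hpq : p.label ≠ q.label) (hvw : ∀ r ∈ v, r ∈ w) (pos : Bool)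
    (hslide : ∀ (h : ℕ → G) (g : G), IsColoring v h g →
      IsColoring w (slide p.label q.label pos h) g) :
    ColoringTransfer G v w := by
  intro h g hg
  refine ⟨slide p.label q.label pos h, g, hslide h g hg, .refl g,
    colorGroup_le_iff.2 ⟨base_mem_colorGroup w _ g, fun r hr => ?_⟩⟩
  have hmem : ∀ r ∈ w, slide p.label q.label pos h r.label ∈
      colorGroup w (slide p.label q.label pos h) g := fun r hr => label_mem_colorGroup hr _ g
  rcases eq_or_ne r.label q.label with hrq | hrq
  · have hpmem := hmem p hp
    have hqmem := hmem q hq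
    rw [slide_of_ne hpq] at hpmem
    rw [slide_self] at hqmem
    rw [hrq]
    exact (undercross_mem_iff hpmem).1 hqmem
  · have hrmem := hmem r (hvw r hr)
    rwa [slide_of_ne hrq] at hrmem

theorem third_labels_ne {a b c : ℕ} {sa sb sc : Bool} {w W : GaussWord} (hw : w.IsCode)
    (hperm : w.Perm ([⟨a, true, sa⟩, ⟨b, true, sb⟩, ⟨a, false, sa⟩, ⟨c, true, sc⟩,
      ⟨b, false, sb⟩, ⟨c, false, sc⟩] ++ W)) :
    a ≠ c ∧ b ≠ c ∧ ∀ p ∈ W, p.label ≠ c := by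
  replace hw := hw.perm hperm
  have hnodup := List.nodup_append.1 hw.1
  refine ⟨?_, ?_, hw.label_ne_of_mem_append (p := ⟨c, true, sc⟩) (by simp)
    (by simp [Passage.partner])⟩
  · refine hw.label_ne_of_ne (p := ⟨c, false, sc⟩) (q := ⟨a, false, sa⟩) (by simp) (by simp) ?_ rfl
    rintro heq
    simp [heq] at hnodup
  · refine hw.label_ne_of_ne (p := ⟨c, false, sc⟩) (q := ⟨b, false, sb⟩) (by simp) (by simp) ?_ rfl
    rintro heq
    simp [heq] at hnodup

theorem third {a b c : ℕ} {sa sb sc dt dm db : Bool} {A B C : GaussWord}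
    (hab : (sa ^^ sb) = (dm ^^ db))
    (hcode : GaussWord.IsCode (strand dt ⟨a, true, sa⟩ ⟨b, true, sb⟩ ++ A ++
      strand dm ⟨a, false, sa⟩ ⟨c, true, sc⟩ ++ B ++
      strand db ⟨b, false, sb⟩ ⟨c, false, sc⟩ ++ C)) :
    ColoringTransfer G
      (strand dt ⟨a, true, sa⟩ ⟨b, true, sb⟩ ++ A ++
        strand dm ⟨a, false, sa⟩ ⟨c, true, sc⟩ ++ B ++
        strand db ⟨b, false, sb⟩ ⟨c, false, sc⟩ ++ C)
      (strand (!dt) ⟨a, true, sa⟩ ⟨b, true, sb⟩ ++ A ++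
        strand (!dm) ⟨a, false, sa⟩ ⟨c, true, sc⟩ ++ B ++
        strand (!db) ⟨b, false, sb⟩ ⟨c, false, sc⟩ ++ C) := by
  obtain ⟨hac, hbc, hABC⟩ := third_labels_ne (a := a) (b := b) (c := c) (sa := sa)
      (sb := sb) (sc := sc) (W := A ++ (B ++ C)) hcode (by
    refine List.perm_iff_count.2 fun p => ?_
    simp only [List.count_append, (strand_perm _ _ _).count_eq, List.count_cons, List.count_nil]
    ring)
  simp only [List.mem_append, or_imp, forall_and] at hABC
  obtain rfl : ((sa ^^ dm) ^^ db) = sb := by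
    rw [Bool.xor_assoc, ← hab, ← Bool.xor_assoc, Bool.xor_self, Bool.false_xor]
  refine of_slide (p := ⟨a, true, sa⟩) (q := ⟨c, true, sc⟩) (by simp [mem_strand])
    (by simp [mem_strand]) hac (by simp [mem_strand]) (sa ^^ dm) fun h g hg => ?_
  have hlabel : h a = h b := by
    simp only [IsColoring, transport_append_iff, transport_over_pair_iff] at hg
    obtain ⟨_, ⟨_, ⟨_, ⟨_, ⟨_, ⟨⟨ha, hb⟩, _⟩, _⟩, _⟩, _⟩, _⟩, _⟩ := hg
    exact ha.trans hb.symm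
  simpa only [IsColoring, transport_append, transport_slide_top hac hbc,
    transport_slide_middle hac, transport_slide_bottom hbc hlabel,
    transport_slide_of_forall_ne hABC.1, transport_slide_of_forall_ne hABC.2.1,
    transport_slide_of_forall_ne hABC.2.2] using hg

theorem third' {a b c : ℕ} {sa sb sc dt dm db : Bool} {A B C : GaussWord}
    (hab : (sa ^^ sb) = (dm ^^ db))
    (hcode : GaussWord.IsCode (strand dt ⟨a, true, sa⟩ ⟨b, true, sb⟩ ++ A ++
      strand db ⟨b, false, sb⟩ ⟨c, false, sc⟩ ++ B ++
      strand dm ⟨a, false, sa⟩ ⟨c, true, sc⟩ ++ C)) :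
    ColoringTransfer G
      (strand dt ⟨a, true, sa⟩ ⟨b, true, sb⟩ ++ A ++
        strand db ⟨b, false, sb⟩ ⟨c, false, sc⟩ ++ B ++
        strand dm ⟨a, false, sa⟩ ⟨c, true, sc⟩ ++ C)
      (strand (!dt) ⟨a, true, sa⟩ ⟨b, true, sb⟩ ++ A ++
        strand (!db) ⟨b, false, sb⟩ ⟨c, false, sc⟩ ++ B ++
        strand (!dm) ⟨a, false, sa⟩ ⟨c, true, sc⟩ ++ C) := by
  obtain ⟨hac, hbc, hABC⟩ := third_labels_ne (a := a) (b := b) (c := c) (sa := sa)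
      (sb := sb) (sc := sc) (W := A ++ (B ++ C)) hcode (by
    refine List.perm_iff_count.2 fun p => ?_
    simp only [List.count_append, (strand_perm _ _ _).count_eq, List.count_cons, List.count_nil]
    ring)
  simp only [List.mem_append, or_imp, forall_and] at hABC
  obtain rfl : ((sa ^^ dm) ^^ db) = sb := by
    rw [Bool.xor_assoc, ← hab, ← Bool.xor_assoc, Bool.xor_self, Bool.false_xor]
  refine of_slide (p := ⟨a, true, sa⟩) (q := ⟨c, true, sc⟩) (by simp [mem_strand])
    (by simp [mem_strand]) hac (by simp [mem_strand]) (sa ^^ dm) fun h g hg => ?_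
  have hlabel : h a = h b := by
    simp only [IsColoring, transport_append_iff, transport_over_pair_iff] at hg
    obtain ⟨_, ⟨_, ⟨_, ⟨_, ⟨_, ⟨⟨ha, hb⟩, _⟩, _⟩, _⟩, _⟩, _⟩, _⟩ := hg
    exact ha.trans hb.symm
  simpa only [IsColoring, transport_append, transport_slide_top hac hbc,
    transport_slide_middle hac, transport_slide_bottom hbc hlabel,
    transport_slide_of_forall_ne hABC.1, transport_slide_of_forall_ne hABC.2.1,
    transport_slide_of_forall_ne hABC.2.2] using hg

theorem of_move {v w : GaussWord} (hv : v.IsCode) (hw : w.IsCode) (hvw : Move v w) :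
    ColoringTransfer G v w ∧ ColoringTransfer G w v := by
  cases hvw with
  | rotate A B => exact ⟨rotate A B, rotate B A⟩
  | relabel σ => exact ⟨relabel σ v, relabel_symm σ v⟩
  | first k o s => exact ⟨first hw, first_symm k o s v⟩
  | second k l o s d A B => exact ⟨second hw, second_symm k l o s d A B⟩
  | third a b c sa sb sc dt dm db A B C hab =>
    refine ⟨third hab hv, ?_⟩
    simpa only [Bool.not_not] using third (G := G) (dm := !dm) (db := !db) (by simpa using hab) hw
  | third' a b c sa sb sc dt dm db A B C hab =>
    refine ⟨third' hab hv, ?_⟩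
    simpa only [Bool.not_not] using third' (G := G) (dm := !dm) (db := !db) (by simpa using hab) hw

end ColoringTransfer

end Moves

/-! ### Meridians and bridges -/

namespace GaussWord

theorem forall_of_next {w : GaussWord} {P : Fin w.length → Prop} {i : Fin w.length} (hi : P i)
    (hnext : ∀ j, P j → P (w.next j)) (j : Fin w.length) : P j := by
  have hiter (k : ℕ) : P ((finRotate w.length ^ k) i) := by
    induction k with
    | zero => exact hi
    | succ k ih =>
      rw [pow_succ', Equiv.Perm.mul_apply]
      exact hnext _ ih
  rcases le_or_gt 2 w.length with hlen | hlen
  · have hmove (l : Fin w.length) : finRotate w.length l ≠ l := by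
      rw [← Equiv.Perm.mem_support, support_finRotate_of_le hlen]
      exact Finset.mem_univ l
    obtain ⟨k, rfl⟩ := (isCycle_finRotate_of_le hlen).exists_pow_eq (hmove i) (hmove j)
    exact hiter k
  · have : Subsingleton (Fin w.length) := Fin.subsingleton_iff_le_one.2 (by omega)
    exact Subsingleton.elim i j ▸ hi

namespace IsCode

variable {w : GaussWord}

theorem exists_isOver_eq (hw : w.IsCode) {p : Passage} (hp : p ∈ w) (o : Bool) :
    ∃ i, (w.get i).isOver = o ∧ (w.get i).label = p.label := by
  rcases Bool.eq_or_eq_not p.isOver o with ho | ho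
  · obtain ⟨i, rfl⟩ := List.mem_iff_get.1 hp
    exact ⟨i, ho, rfl⟩
  · obtain ⟨i, hi⟩ := List.mem_iff_get.1 (hw.2.1 p hp)
    rw [← Bool.not_eq_eq_eq_not] at ho
    exact ⟨i, by rw [hi]; exact ho, by rw [hi]; rfl⟩

theorem injective_label_overpass (hw : w.IsCode) :
    Function.Injective fun i : {i // (w.get i).isOver = true} => (w.get i).label := by
  intro i j hij
  have hget : w.get i = w.get j := by
    by_contra hne
    exact hw.label_ne_of_ne (w.get_mem j) (w.get_mem i) hne (i.2.trans j.2.symm) hij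
  exact Subtype.ext (hw.1.injective_get hget)

end IsCode

end GaussWord

theorem apply_castSucc_finRotate {α : Type*} {n : ℕ} {f : Fin (n + 1) → α}
    (hf : f (Fin.last n) = f 0) (i : Fin n) : f (finRotate n i).castSucc = f i.succ := by
  cases n with
  | zero => exact i.elim0
  | succ n =>
    rcases eq_or_ne i (Fin.last n) with rfl | hi
    · rw [finRotate_last, Fin.castSucc_zero, Fin.succ_last, hf]
    · exact congrArg f (Fin.ext (coe_finRotate_of_ne_last hi))

namespace KnotDiagram

section WirtingerGroup

variable (D : KnotDiagram)

/-- The Wirtinger generator of the strand that contains a given edge, as an element of the knot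
group. -/
def meridian (e : Fin (D.word.length + 1)) : D.WirtingerGroup :=
  PresentedGroup.of (Quot.mk D.Joined e)

theorem meridian_last : D.meridian (Fin.last _) = D.meridian 0 :=
  congrArg PresentedGroup.of (Quot.sound .basePoint)

variable {D}

theorem meridian_succ_of_isOver {i : Fin D.word.length} (hi : (D.word.get i).isOver = true) :
    D.meridian i.succ = D.meridian i.castSucc :=
  (congrArg PresentedGroup.of (Quot.sound (.overpass i hi))).symm

theorem meridian_next (i : Fin D.word.length) :
    D.meridian (D.word.next i).castSucc = D.meridian i.succ :=
  apply_castSucc_finRotate D.meridian_last i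

variable (D) in
theorem closure_range_meridian : Subgroup.closure (Set.range D.meridian) = ⊤ := by
  rw [← PresentedGroup.closure_range_of]
  exact congrArg Subgroup.closure (Quot.mk_surjective.range_comp PresentedGroup.of)

theorem forall_wirtingerRels_eq_one_iff {G : Type*} [Group G] (φ : FreeGroup D.Arc →* G) :
    (∀ r ∈ D.wirtingerRels, φ r = 1) ↔
      ∀ i j, (D.word.get i).isOver = false → D.word.get j = (D.word.get i).partner →
        undercross (D.word.get i).isPos (φ (D.gen j.castSucc)) (φ (D.gen i.castSucc)) =
          φ (D.gen i.succ) := by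
  have hrel (s : Bool) (x y z : FreeGroup D.Arc) :
      φ (if s then z * y * (x * z)⁻¹ else y * z * (z * x)⁻¹) = 1 ↔
        undercross s (φ z) (φ x) = φ y := by
    cases s
    · rw [undercross, if_neg Bool.false_ne_true, if_neg Bool.false_ne_true, map_mul, map_inv,
        mul_inv_eq_one, map_mul, map_mul, mul_inv_eq_iff_eq_mul, eq_comm]
    · rw [undercross, if_pos rfl, if_pos rfl, map_mul, map_inv, mul_inv_eq_one, map_mul, map_mul,
        mul_assoc, inv_mul_eq_iff_eq_mul, eq_comm]
  simp only [← hrel]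
  constructor
  · exact fun h i j hi hj => h _ ⟨i, j, hi, hj, rfl⟩
  · rintro h r ⟨i, j, hi, hj, rfl⟩
    exact h i j hi hj

variable (D) in
theorem exists_isEdgeColoring_meridian :
    ∃ h : ℕ → D.WirtingerGroup, IsEdgeColoring D.word h D.meridian := by
  obtain ⟨h, hlabel⟩ : ∃ h : ℕ → D.WirtingerGroup, ∀ j, (D.word.get j).isOver = true →
      h (D.word.get j).label = D.meridian j.castSucc :=
    ⟨_, fun j hj => D.isCode.injective_label_overpass.extend_apply
      (fun j => D.meridian j.1.castSucc) 1 ⟨j, hj⟩⟩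
  refine ⟨h, fun i => ?_⟩
  unfold Passes
  split_ifs with hi
  · exact ⟨hlabel i hi, (meridian_succ_of_isOver hi).symm⟩
  · rw [Bool.not_eq_true] at hi
    obtain ⟨j, hj⟩ := List.mem_iff_get.1 (D.isCode.2.1 _ (D.word.get_mem i))
    have hlabel_i : h (D.word.get i).label = D.meridian j.castSucc := by
      rw [← hlabel j (by rw [hj, Passage.partner, hi, Bool.not_false]), hj, Passage.partner]
    rw [hlabel_i]
    exact (forall_wirtingerRels_eq_one_iff (PresentedGroup.mk D.wirtingerRels)).1
      (fun _ => PresentedGroup.one_of_mem) i j hi hj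

theorem exists_hom_of_isColoring {G : Type*} [Group G] {h : ℕ → G} {g : G}
    (hg : IsColoring D.word h g) :
    ∃ φ : D.WirtingerGroup →* G, φ (D.meridian 0) = g ∧ colorGroup D.word h g ≤ φ.range := by
  obtain ⟨f, hf, h0, hlast⟩ := transport_iff_exists_isEdgeColoring.1 hg
  have hover : ∀ i, (D.word.get i).isOver = true →
      h (D.word.get i).label = f i.castSucc ∧ f i.castSucc = f i.succ := by
    intro i hi
    have hpass := hf i
    rwa [Passes, if_pos hi] at hpass
  let color : D.Arc → G := Quot.lift f fun _ _ hjoined => by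
    cases hjoined with
    | basePoint => exact hlast.trans h0.symm
    | overpass i hi => exact (hover i hi).2
  have hcolor (e : Fin (D.word.length + 1)) : FreeGroup.lift color (D.gen e) = f e :=
    FreeGroup.lift_apply_of
  have hrels : ∀ r ∈ D.wirtingerRels, FreeGroup.lift color r = 1 := by
    refine (forall_wirtingerRels_eq_one_iff _).2 fun i j hi hj => ?_
    have hpass := hf i
    have hlabel : h (D.word.get i).label = f j.castSucc := by
      rw [← (hover j (by rw [hj, Passage.partner, hi, Bool.not_false])).1, hj, Passage.partner]
    rw [Passes, if_neg (by rw [hi]; exact Bool.false_ne_true), hlabel] at hpass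
    rwa [hcolor, hcolor, hcolor]
  have hφ (e : Fin (D.word.length + 1)) :
      PresentedGroup.toGroup hrels (D.meridian e) = f e := PresentedGroup.toGroup.of hrels
  refine ⟨PresentedGroup.toGroup hrels, (hφ 0).trans h0, colorGroup_le_iff.2 ⟨?_, fun p hp => ?_⟩⟩
  · exact ⟨D.meridian 0, (hφ 0).trans h0⟩
  · obtain ⟨j, hj, hjp⟩ := D.isCode.exists_isOver_eq hp true
    exact ⟨D.meridian j.castSucc, by rw [hφ, ← hjp, (hover j hj).1]⟩

theorem isConj_meridian_zero (e : Fin (D.word.length + 1)) :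
    IsConj (D.meridian 0) (D.meridian e) := by
  obtain ⟨h, hh⟩ := D.exists_isEdgeColoring_meridian
  exact hh.isConj e

theorem isMeridian_iff {g : D.WirtingerGroup} :
    D.IsMeridian g ↔ g ∈ signedConjugates (D.meridian 0) := by
  constructor
  · rintro ⟨x, hx⟩
    obtain ⟨e, rfl⟩ := Quot.mk_surjective x
    rw [signedConjugates_eq_of_isConj (isConj_meridian_zero e)]
    exact hx
  · exact fun hg => ⟨Quot.mk _ 0, hg⟩

theorem exists_surjective_of_coloringTransfer {D E : KnotDiagram}
    (hDE : ColoringTransfer D.WirtingerGroup D.word E.word) :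
    ∃ φ : E.WirtingerGroup →* D.WirtingerGroup,
      Function.Surjective φ ∧ IsConj (D.meridian 0) (φ (E.meridian 0)) := by
  obtain ⟨h, hh⟩ := D.exists_isEdgeColoring_meridian
  have hcol : IsColoring D.word h (D.meridian 0) :=
    transport_iff_exists_isEdgeColoring.2 ⟨D.meridian, hh, rfl, D.meridian_last⟩
  have htop : colorGroup D.word h (D.meridian 0) = ⊤ := by
    rw [eq_top_iff, ← D.closure_range_meridian, Subgroup.closure_le]
    rintro _ ⟨e, rfl⟩
    exact (hh.mem_iff (fun p hp => label_mem_colorGroup hp h _) e).2 (base_mem_colorGroup _ h _)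
  obtain ⟨h', g', hcol', hconj, hle⟩ := hDE h _ hcol
  obtain ⟨φ, rfl, hφ⟩ := exists_hom_of_isColoring hcol'
  exact ⟨φ, MonoidHom.range_eq_top.1 (top_le_iff.1 (htop ▸ hle.trans hφ)), hconj⟩

/-- The Wirtinger group of a diagram is generated by `n` (not necessarily distinct) meridians. -/
def GeneratedByMeridians (D : KnotDiagram) (n : ℕ) : Prop :=
  ∃ m : Fin n → D.WirtingerGroup,
    (∀ i, D.IsMeridian (m i)) ∧ Subgroup.closure (Set.range m) = ⊤

theorem GeneratedByMeridians.of_coloringTransfer {D E : KnotDiagram} {n : ℕ}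
    (hE : E.GeneratedByMeridians n)
    (hDE : ColoringTransfer D.WirtingerGroup D.word E.word) : D.GeneratedByMeridians n := by
  obtain ⟨m, hm, hgen⟩ := hE
  obtain ⟨φ, hφ, hconj⟩ := exists_surjective_of_coloringTransfer hDE
  refine ⟨φ ∘ m, fun i => ?_, ?_⟩
  · rw [isMeridian_iff, signedConjugates_eq_of_isConj hconj]
    exact map_mem_signedConjugates φ (isMeridian_iff.1 (hm i))
  · rw [Set.range_comp, ← MonoidHom.map_closure, hgen, Subgroup.map_top_of_surjective φ hφ]

theorem generatedByMeridians_congr {D E : KnotDiagram}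
    (hDE : Relation.EqvGen (fun D E : KnotDiagram => Move D.word E.word) D E) (n : ℕ) :
    D.GeneratedByMeridians n ↔ E.GeneratedByMeridians n := by
  induction hDE with
  | rel D E hmove =>
    exact ⟨fun h => h.of_coloringTransfer (ColoringTransfer.of_move D.isCode E.isCode hmove).2,
      fun h => h.of_coloringTransfer (ColoringTransfer.of_move D.isCode E.isCode hmove).1⟩
  | refl => rfl
  | symm _ _ _ ih => exact ih.symm
  | trans _ _ _ _ _ ih₁ ih₂ => exact ih₁.trans ih₂

theorem Represents.generatedByMeridians {D : KnotDiagram} {K : Knot} {n : ℕ}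
    (hD : D.Represents K) (hK : K.GroupGeneratedByMeridians n) : D.GeneratedByMeridians n := by
  obtain ⟨E, hE, hgen⟩ := hK
  exact (generatedByMeridians_congr (Quotient.exact (hE.trans hD.symm)) n).1 hgen

end WirtingerGroup

section BridgePresentation

variable {D : KnotDiagram} {H : Subgroup D.WirtingerGroup}

theorem meridian_mem_of_forall_overbridge (hw : D.word ≠ [])
    (hH : ∀ i, (D.word.get i).isOver = false → (D.word.get (D.word.next i)).isOver = true →
      D.meridian i.succ ∈ H) (e : Fin (D.word.length + 1)) : D.meridian e ∈ H := by
  obtain ⟨p, hp⟩ := List.exists_mem_of_ne_nil _ hw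
  obtain ⟨i, hi, -⟩ := D.isCode.exists_isOver_eq hp false
  have hover : ∀ j, (D.word.get j).isOver = true → D.meridian j.castSucc ∈ H := by
    refine GaussWord.forall_of_next (i := i)
      (fun h => absurd (hi.symm.trans h) Bool.false_ne_true) fun j ih hnext => ?_
    rw [meridian_next]
    cases hj : (D.word.get j).isOver
    · exact hH j hj hnext
    · rw [meridian_succ_of_isOver hj]
      exact ih hj
  obtain ⟨h, hh⟩ := D.exists_isEdgeColoring_meridian
  have hlabel : ∀ p ∈ D.word, h p.label ∈ H := by
    intro p hp
    obtain ⟨j, hj, hjp⟩ := D.isCode.exists_isOver_eq hp true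
    have hpass := hh j
    rw [Passes, if_pos hj] at hpass
    rw [← hjp, hpass.1]
    exact hover j hj
  obtain ⟨j, hj, -⟩ := D.isCode.exists_isOver_eq hp true
  exact (hh.mem_iff hlabel e).2 ((hh.mem_iff hlabel _).1 (hover j hj))

variable (D) in
theorem generatedByMeridians_bridgeCount : D.GeneratedByMeridians D.bridgeCount := by
  unfold bridgeCount
  split_ifs with hw
  · refine ⟨fun _ => D.meridian 0, fun _ => isMeridian_iff.2 (mem_signedConjugates_self _), ?_⟩
    have : Subsingleton (Fin (D.word.length + 1)) := by
      rw [hw]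
      exact inferInstanceAs (Subsingleton (Fin 1))
    rw [Set.range_const, ← D.closure_range_meridian, Set.range_eq_singleton_iff.2]
    exact fun e => congrArg D.meridian (Subsingleton.elim e 0)
  · set S := Finset.univ.filter fun i : Fin D.word.length =>
      (D.word.get i).isOver = false ∧ (D.word.get (D.word.next i)).isOver = true
    refine ⟨fun k => D.meridian (S.equivFin.symm k).1.succ,
      fun k => isMeridian_iff.2 (.inl (isConj_meridian_zero _)), ?_⟩
    rw [eq_top_iff, ← D.closure_range_meridian, Subgroup.closure_le]
    rintro _ ⟨e, rfl⟩
    refine meridian_mem_of_forall_overbridge hw (fun i hi hnext => ?_) e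
    have hiS : i ∈ S := Finset.mem_filter.2 ⟨Finset.mem_univ i, hi, hnext⟩
    exact Subgroup.subset_closure ⟨S.equivFin ⟨i, hiS⟩, by simp⟩

end BridgePresentation

end KnotDiagram

theorem Knot.groupGeneratedByMeridians_bridgeNumber (K : Knot) :
    K.GroupGeneratedByMeridians K.bridgeNumber := by
  have hne : {n | ∃ D : KnotDiagram, D.Represents K ∧ D.bridgeCount = n}.Nonempty := by
    obtain ⟨D, hD⟩ := Quotient.exists_rep K
    exact ⟨D.bridgeCount, D, hD, rfl⟩
  obtain ⟨D, hD, hbridge⟩ := Nat.sInf_mem hne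
  rw [bridgeNumber, ← hbridge]
  exact ⟨D, hD, D.generatedByMeridians_bridgeCount⟩

/-! ### Cyclicity of `R₄` and `S₄` -/

namespace KnotDiagram

variable (D : KnotDiagram)

/-- The quotient map from the knot group onto the Dabkowski–Sahi group. -/
def toR₄ : D.WirtingerGroup →* D.R₄ :=
  PresentedGroup.map (.id _) fun _ => .inl

variable {D}

theorem toR₄_of (x : D.Arc) : D.toR₄ (PresentedGroup.of x) = PresentedGroup.of x :=
  rfl

theorem exists_toR₄_meridian_eq (e : Fin (D.word.length + 1)) :
    ∃ x : D.Arc, D.toR₄ (D.meridian e) = PresentedGroup.of x :=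
  ⟨Quot.mk _ e, toR₄_of _⟩

theorem toR₄_surjective : Function.Surjective D.toR₄ := by
  rw [← MonoidHom.range_eq_top, eq_top_iff, ← PresentedGroup.closure_range_of,
    Subgroup.closure_le]
  rintro _ ⟨x, rfl⟩
  exact ⟨PresentedGroup.of x, toR₄_of x⟩

theorem exists_mem_conjugates_mk_eq {x : D.Arc} {y : D.R₄}
    (hy : y ∈ signedConjugates (PresentedGroup.of x)) :
    ∃ c ∈ D.conjugates, PresentedGroup.mk _ c = y := by
  rcases hy with hy | hy
  · obtain ⟨u, rfl⟩ := isConj_iff.1 hy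
    obtain ⟨g, rfl⟩ := PresentedGroup.mk_surjective _ u
    exact ⟨_, ⟨g, x, .inl rfl⟩, by rw [map_mul, map_mul, map_inv]; rfl⟩
  · obtain ⟨u, rfl⟩ := isConj_iff.1 hy
    obtain ⟨g, rfl⟩ := PresentedGroup.mk_surjective _ u
    exact ⟨_, ⟨g, x, .inr rfl⟩, by rw [map_mul, map_mul, map_inv, map_inv]; rfl⟩

theorem sq_mul_eq_of_mem_signedConjugates {x : D.Arc} {y z : D.R₄}
    (hy : y ∈ signedConjugates (PresentedGroup.of x))
    (hz : z ∈ signedConjugates (PresentedGroup.of x)) : (y * z) ^ 2 = (z * y) ^ 2 := by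
  obtain ⟨c, hc, rfl⟩ := exists_mem_conjugates_mk_eq hy
  obtain ⟨d, hd, rfl⟩ := exists_mem_conjugates_mk_eq hz
  rw [← map_mul, ← map_mul, ← map_pow, ← map_pow, ← mul_inv_eq_one, ← map_inv, ← map_mul]
  exact PresentedGroup.one_of_mem (.inr ⟨c, hc, d, hd, rfl⟩)

theorem GeneratedByMeridians.zpowers_toR₄_meridian (hD : D.GeneratedByMeridians 3) :
    Subgroup.zpowers (D.toR₄ (D.meridian 0)) = ⊤ := by
  obtain ⟨m, hm, hgen⟩ := hD
  have hrange : Set.range (D.toR₄ ∘ m) = {D.toR₄ (m 0), D.toR₄ (m 1), D.toR₄ (m 2)} := by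
    ext g
    simp [Fin.exists_fin_succ, eq_comm]
  have hmem (i : Fin 3) : D.toR₄ (m i) ∈ signedConjugates (D.toR₄ (D.meridian 0)) :=
    map_mem_signedConjugates D.toR₄ (isMeridian_iff.1 (hm i))
  refine zpowers_eq_top_of_fourMove (a := D.toR₄ (m 0)) (b := D.toR₄ (m 1)) (c := D.toR₄ (m 2))
    ?_ ?_ fun y hy z hz => ?_
  · rw [← hrange, Set.range_comp, ← MonoidHom.map_closure, hgen,
      Subgroup.map_top_of_surjective _ toR₄_surjective]
  · rw [← hrange]
    rintro _ ⟨i, rfl⟩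
    exact hmem i
  · obtain ⟨x, hx⟩ := exists_toR₄_meridian_eq (D := D) 0
    rw [hx] at hy hz
    exact sq_mul_eq_of_mem_signedConjugates hy hz

variable {A : Type*} [CommGroup A]

theorem exists_hom_R₄_of_eq (D : KnotDiagram) (a : A) :
    ∃ f : D.R₄ →* A, ∀ x, f (PresentedGroup.of x) = a := by
  have hrels : ∀ r ∈ D.wirtingerRels ∪ D.fourMoveRels, FreeGroup.lift (fun _ => a) r = 1 := by
    rintro r (⟨i, j, -, -, rfl⟩ | ⟨c, -, d, -, rfl⟩)
    · have hgen (e) : FreeGroup.lift (fun _ => a) (D.gen e) = a := FreeGroup.lift_apply_of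
      split_ifs <;> rw [map_mul, map_inv, map_mul, map_mul, hgen, hgen, hgen, mul_inv_cancel]
    · rw [map_mul, map_inv, map_pow, map_pow, map_mul, map_mul, mul_comm (FreeGroup.lift _ d),
        mul_inv_cancel]
  exact ⟨PresentedGroup.toGroup hrels, fun x => PresentedGroup.toGroup.of hrels⟩

theorem exists_hom_S₄_of_eq (D : KnotDiagram) {a : A} (ha : a ^ 2 = 1) :
    ∃ f : D.S₄ →* A, ∀ x, f (PresentedGroup.of x : D.R₄) = a := by
  obtain ⟨f, hf⟩ := D.exists_hom_R₄_of_eq a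
  have hsquares : D.squares ≤ f.ker := by
    refine Subgroup.normalClosure_le_normal ?_
    rintro _ ⟨x, rfl⟩
    rw [SetLike.mem_coe, MonoidHom.mem_ker, map_pow, hf, ha]
  exact ⟨QuotientGroup.lift D.squares f hsquares, hf⟩

theorem GeneratedByMeridians.nonempty_R₄_mulEquiv (hD : D.GeneratedByMeridians 3) :
    Nonempty (D.R₄ ≃* Multiplicative ℤ) := by
  obtain ⟨f, hf⟩ := D.exists_hom_R₄_of_eq (Multiplicative.ofAdd (1 : ℤ))
  refine nonempty_mulEquiv_zmod (n := 0) hD.zpowers_toR₄_meridian (pow_zero _) f ?_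
  obtain ⟨x, hx⟩ := exists_toR₄_meridian_eq (D := D) 0
  exact (congrArg f hx).trans (hf x)

theorem GeneratedByMeridians.nonempty_S₄_mulEquiv (hD : D.GeneratedByMeridians 3) :
    Nonempty (D.S₄ ≃* Multiplicative (ZMod 2)) := by
  obtain ⟨f, hf⟩ := D.exists_hom_S₄_of_eq (a := Multiplicative.ofAdd (1 : ZMod 2)) (by decide)
  obtain ⟨x, hx⟩ := exists_toR₄_meridian_eq (D := D) 0
  refine nonempty_mulEquiv_zmod (a := QuotientGroup.mk' D.squares (D.toR₄ (D.meridian 0)))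
    ?_ ?_ f ?_
  · rw [← MonoidHom.map_zpowers, hD.zpowers_toR₄_meridian,
      Subgroup.map_top_of_surjective _ (QuotientGroup.mk'_surjective _)]
  · rw [← map_pow, hx]
    exact (QuotientGroup.eq_one_iff _).2 (Subgroup.subset_normalClosure ⟨_, rfl⟩)
  · rw [hx]
    exact hf x

end KnotDiagram

end FourMove

theorem mainTheorem3 (K : FourMove.Knot) :
    (K.bridgeNumber = 3 → ∀ D : FourMove.KnotDiagram, D.Represents K →
      Nonempty (D.S₄ ≃* Multiplicative (ZMod 2)) ∧ Nonempty (D.R₄ ≃* Multiplicative ℤ)) ∧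
    (K.GroupGeneratedByMeridians 3 → ∀ D : FourMove.KnotDiagram, D.Represents K →
      Nonempty (D.S₄ ≃* Multiplicative (ZMod 2)) ∧ Nonempty (D.R₄ ≃* Multiplicative ℤ)) := by
  have of_generated (hK : K.GroupGeneratedByMeridians 3) (D : FourMove.KnotDiagram)
      (hD : D.Represents K) :
      Nonempty (D.S₄ ≃* Multiplicative (ZMod 2)) ∧ Nonempty (D.R₄ ≃* Multiplicative ℤ) :=
    have hgen := hD.generatedByMeridians hK
    ⟨hgen.nonempty_S₄_mulEquiv, hgen.nonempty_R₄_mulEquiv⟩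
  exact ⟨fun hK => of_generated (hK ▸ K.groupGeneratedByMeridians_bridgeNumber), of_generated⟩
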